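/- Conventions. A representation of a set $X$ is a surjective partial function $\delta_X:\subseteq\mathbb N^{\mathbb N}\to X$; a represented space is a set with a representation. A multi-valued function $f:\subseteq X\rightrightarrows Y$ assigns to each $x\in X$ a set $f(x)\subseteq Y$, and $\mathrm{dom}(f)=\{x: f(x)\neq\emptyset\}$. A partial function $F:\subseteq\mathbb N^{\mathbb N}\to\mathbb N^{\mathbb N}$ is a realizer of $f:\subseteq(X,\delta_X)\rightrightarrows(Y,\delta_Y)$, written $F\vdash f$, if $\delta_Y F(p)\in f(\delta_X(p))$ for all $p\in\mathrm{dom}(f\delta_X)$. We write $\langle\cdot,\cdot\rangle$ for the standard pairing of $\mathbb N^{\mathbb N}$, and $f\leq_{\mathrm W}g$ if there are computable $K,H:\subseteq\mathbb N^{\mathbb N}\to\mathbb N^{\mathbb N}$ such that $K\circ\langle\mathrm{id},G\circ H\rangle\vdash f$ for all $G\vdash g$. Sierpiński space $\mathbb S=\{0,1\}$ is represented by $\delta_{\mathbb S}(p)=1\iff(\exists n)\,p(n)=0$. A set $A\subseteq\mathbb N^{\mathbb N}$ is a represented space through the restriction of the identity to $A$. A subset $U$ of a represented space is open if its characteristic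 function into $\mathbb S$ is continuous (i.e. has a continuous realizer), and closed if its complement is open; a name of a closed set is a name, with respect to the canonical function space representation, of the characteristic function of its complement. Closed choice $\mathsf C_A$ is the multi-valued function that maps each non-empty closed subset $B$ of $A$, so represented, to the set of its elements. A multi-valued function $f:\subseteq X\rightrightarrows Y$ on represented spaces is non-deterministically computable with advice space $A\subseteq\mathbb N^{\mathbb N}$ if there are computable $F_1,F_2:\subseteq\mathbb N^{\mathbb N}\to\mathbb N^{\mathbb N}$ such that $\langle p,r\rangle\in\mathrm{dom}(F_2)$ for all $p\in\mathrm{dom}(f\delta_X)$ and $r\in A$, and such that for each $p\in\mathrm{dom}(f\delta_X)$: 1. there is some $r\in A$ with $\delta_{\mathbb S}F_2\langle p,r\rangle=0$; 2. for all $r\in A$, if $\delta_{\mathbb S}F_2\langle p,r\rangle=0$, then $\delta_Y F_1\langle p,r\rangle\in f(\delta_X(p))$. Theorem (Non-deterministic computability). Let $(X,\delta_X)$ and $(Y,\delta_Y)$ be represented spaces, let $A\subseteq\mathbb N^{\mathbb N}$ and let $f:\subseteq X\rightrightarrows Y$ be a multi-valued function. Then $f\leq_{\mathrm W}\mathsf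 C_A$ if and only if $f$ is non-deterministically computable with advice space $A$. -/

import Mathlib

namespace TTE

/-- Baire space `ℕ^ℕ`, with the product topology of the discrete topology on `ℕ`. -/
abbrev Baire : Type := ℕ → ℕ

/-- The bijective pairing `⟨p, q⟩ = (p 0, q 0, p 1, q 1, …)` of Baire space. -/
def pairing (p q : Baire) : Baire := fun n => if n % 2 = 0 then p (n / 2) else q (n / 2)

/-! ### Computable functions on Baire space -/

/-- The partial recursive functionals `Φ : ℕ^ℕ × ℕ ⇀ ℕ`: partial functions of a number that are
computable uniformly in an oracle `p`. This is Mathlib's `Nat.RecursiveIn` with a variable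
oracle. -/
inductive RecFunctional : (Baire → ℕ →. ℕ) → Prop
  | zero : RecFunctional fun _ _ => Part.some 0
  | succ : RecFunctional fun _ n => Part.some (n + 1)
  | left : RecFunctional fun _ n => Part.some n.unpair.1
  | right : RecFunctional fun _ n => Part.some n.unpair.2
  | oracle : RecFunctional fun p n => Part.some (p n)
  | pair {Φ Ψ : Baire → ℕ →. ℕ} (hΦ : RecFunctional Φ) (hΨ : RecFunctional Ψ) :
      RecFunctional fun p n => (Φ p n).bind fun a => (Ψ p n).map fun b => Nat.pair a b
  | comp {Φ Ψ : Baire → ℕ →. ℕ} (hΦ : RecFunctional Φ) (hΨ : RecFunctional Ψ) :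
      RecFunctional fun p n => (Ψ p n).bind fun a => Φ p a
  | prec {Φ Ψ : Baire → ℕ →. ℕ} (hΦ : RecFunctional Φ) (hΨ : RecFunctional Ψ) :
      RecFunctional fun p m =>
        Nat.rec (motive := fun _ => Part ℕ) (Φ p m.unpair.1)
          (fun y IH => IH.bind fun i => Ψ p (Nat.pair m.unpair.1 (Nat.pair y i)))
          m.unpair.2
  | rfind {Φ : Baire → ℕ →. ℕ} (hΦ : RecFunctional Φ) :
      RecFunctional fun p a =>
        Nat.rfind fun n => (Φ p (Nat.pair a n)).map fun m => decide (m = 0)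

/-- A partial function `φ : ℕ ⇀ ℕ`, seen as a partially defined element of Baire space: it is
defined exactly if `φ` is total. -/
def sequenceOf (φ : ℕ →. ℕ) : Part Baire :=
  ⟨∀ n, (φ n).Dom, fun h n => (φ n).get (h n)⟩

theorem mem_sequenceOf {φ : ℕ →. ℕ} {q : Baire} : q ∈ sequenceOf φ ↔ ∀ n, q n ∈ φ n := by
  constructor
  · rintro ⟨h, rfl⟩ n
    exact ⟨h n, rfl⟩
  · intro h
    exact ⟨fun n => (h n).1, funext fun n => (h n).2⟩

/-- `F :⊆ ℕ^ℕ → ℕ^ℕ` is computable: some oracle machine computes, for every input `p`, the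
sequence `F p` (one value at a time) if `p ∈ dom F`, and fails to produce an infinite sequence
otherwise. -/
def IsComputable (F : Baire →. Baire) : Prop :=
  ∃ Φ : Baire → ℕ →. ℕ, RecFunctional Φ ∧ ∀ p, F p = sequenceOf (Φ p)

/-- `F :⊆ ℕ^ℕ → ℕ^ℕ` is continuous (on its domain). -/
def IsContinuous (F : Baire →. Baire) : Prop := Continuous F.asSubtype

/-! ### Represented spaces and realizers -/

/-- A representation of `X`, i.e. a surjective partial function `δ :⊆ ℕ^ℕ → X`, given by its
graph: `δ.IsName p x` says that `p ∈ dom δ` and `δ p = x`. -/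
structure Representation (X : Type*) where
  IsName : Baire → X → Prop
  unique : ∀ {p x y}, IsName p x → IsName p y → x = y
  surj : ∀ x, ∃ p, IsName p x

/-- The domain of a multi-valued function `f :⊆ X ⇉ Y`; such a function is given by its value
sets, and a point is outside of the domain if its value set is empty. -/
def mdom {X Y : Type*} (f : X → Set Y) : Set X := {x | (f x).Nonempty}

/-- `F ⊢ f`: the partial function `F` is a realizer of `f :⊆ (X, δX) ⇉ (Y, δY)`, i.e.
`δY (F p) ∈ f (δX p)` for all `p ∈ dom (f ∘ δX)`. -/
def Realizes {X Y : Type*} (δX : Representation X) (δY : Representation Y)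
    (F : Baire →. Baire) (f : X → Set Y) : Prop :=
  ∀ p x, δX.IsName p x → x ∈ mdom f → ∃ q ∈ F p, ∃ y, δY.IsName q y ∧ y ∈ f x

/-- `K ∘ ⟨id, G ∘ H⟩`, with the natural domain of a composition of partial functions. -/
def reductionComp (K G H : Baire →. Baire) : Baire →. Baire :=
  fun p => (H p).bind fun q => (G q).bind fun r => K (pairing p r)

/-- Weihrauch reducibility `f ≤_W g`. -/
def WeihrauchReducible {X Y U V : Type*} (δX : Representation X) (δY : Representation Y)
    (δU : Representation U) (δV : Representation V) (f : X → Set Y) (g : U → Set V) : Prop :=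
  ∃ K H : Baire →. Baire, IsComputable K ∧ IsComputable H ∧
    ∀ G : Baire →. Baire, Realizes δU δV G g → Realizes δX δY (reductionComp K G H) f

/-! ### The function space representation -/

/-- The value at `n` of the partial function on Baire space coded by `q`, at the argument `p`:
`q` is read as the table of a machine which has seen the first `k` entries of `p` and is asked for
the `n`-th entry of the output. The entry `0` in the table means that more of `p` is needed, the
entry `m + 1` means that the answer is `m`. -/
def evalAt (q p : Baire) (n : ℕ) : Part ℕ :=
  Nat.rfindOpt fun k => Nat.ppred (q (Encodable.encode ((List.range k).map p, n)))

/-- The standard numbering `q ↦ η_q` (by Kleene's associates) of partial continuous functions on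
Baire space. -/
def eta (q : Baire) : Baire →. Baire := fun p => sequenceOf (evalAt q p)

/-- A (total, single-valued) function between represented spaces is continuous if it has a
continuous realizer. -/
def IsContinuousFun {X Y : Type*} (δX : Representation X) (δY : Representation Y)
    (g : X → Y) : Prop :=
  ∃ F : Baire →. Baire, IsContinuous F ∧ Realizes δX δY F fun x => {g x}

theorem ppred_eq_some {a b : ℕ} : Nat.ppred a = some b ↔ a = b + 1 := by
  cases a <;> simp [Nat.ppred, eq_comm]

theorem evalAt_eq {q p : Baire} {n v : ℕ}
    (hv : ∀ k m, q (Encodable.encode ((List.range k).map p, n)) = m + 1 → m = v)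
    (hk : ∃ k m, q (Encodable.encode ((List.range k).map p, n)) = m + 1) :
    v ∈ evalAt q p n := by
  obtain ⟨k, m, h⟩ := hk
  have hd : (evalAt q p n).Dom := Nat.rfindOpt_dom.2 ⟨k, m, ppred_eq_some.2 h⟩
  obtain ⟨w, hw⟩ := Part.dom_iff_mem.1 hd
  obtain ⟨j, hj⟩ := Nat.rfindOpt_spec hw
  rwa [← hv j w (ppred_eq_some.1 hj)]

theorem prefix_eq {p p' : Baire} {k : ℕ}
    (h : (List.range k).map p = (List.range k).map p') : ∀ i < k, p i = p' i := by
  intro i hi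
  exact List.map_inj_left.1 h i (List.mem_range.2 hi)

/-- Every continuous partial function on Baire space is extended by some `η_q`. -/
theorem exists_eta_extends {F : Baire →. Baire} (hF : IsContinuous F) :
    ∃ q, ∀ p, ∀ r ∈ F p, r ∈ eta q p := by
  classical
  let good : List ℕ → ℕ → ℕ → Prop := fun w n m =>
    ∀ p r, (List.range w.length).map p = w → r ∈ F p → r n = m
  let tab : List ℕ × ℕ → ℕ := fun a =>
    if h : ∃ m, good a.1 a.2 m then h.choose + 1 else 0
  let q : Baire := fun c => ((Encodable.decode (α := List ℕ × ℕ) c).map tab).getD 0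
  have hq : ∀ a, q (Encodable.encode a) = tab a := fun a => by
    simp only [q, Encodable.encodek, Option.map_some, Option.getD_some]
  refine ⟨q, fun p r hr => mem_sequenceOf.2 fun n => ?_⟩
  apply evalAt_eq
  · intro k m h
    rw [hq] at h
    by_cases hg : ∃ m, good ((List.range k).map p) n m
    · simp only [tab, dif_pos hg, Nat.add_right_cancel_iff] at h
      have := hg.choose_spec p r (by simp) hr
      rw [this, ← h]
    · simp [tab, dif_neg hg] at h
  · have hp : p ∈ F.Dom := hr.1
    have hval : F.asSubtype ⟨p, hp⟩ = r := Part.get_eq_of_mem hr _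
    have hc : Continuous fun x : F.Dom => F.asSubtype x n := (continuous_apply n).comp hF
    have ho : IsOpen {x : F.Dom | F.asSubtype x n = r n} :=
      (isOpen_discrete {r n}).preimage hc
    obtain ⟨V, hV, hVeq⟩ := isOpen_induced_iff.1 ho
    have hpV : p ∈ V := by
      have : (⟨p, hp⟩ : F.Dom) ∈ Subtype.val ⁻¹' V := by
        rw [hVeq]; simp [hval]
      exact this
    obtain ⟨I, u, hIu, hsub⟩ := isOpen_pi_iff.1 hV p hpV
    obtain ⟨k, hk⟩ : ∃ k, ∀ i ∈ I, i < k :=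
      ⟨I.sup id + 1, fun i hi => Nat.lt_succ_of_le (Finset.le_sup (f := id) hi)⟩
    have hg : ∃ m, good ((List.range k).map p) n m := by
      refine ⟨r n, fun p' r' h hr' => ?_⟩
      rw [List.length_map, List.length_range] at h
      have hp'V : p' ∈ V := hsub fun i hi => by
        rw [prefix_eq h i (hk i hi)]
        exact (hIu i hi).2
      have : (⟨p', hr'.1⟩ : F.Dom) ∈ {x : F.Dom | F.asSubtype x n = r n} := by
        rw [← hVeq]; exact hp'V
      have hval' : F.asSubtype ⟨p', hr'.1⟩ = r' := Part.get_eq_of_mem hr' _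
      rw [← hval']
      exact this
    exact ⟨k, hg.choose, by rw [hq]; simp only [tab, dif_pos hg]⟩

/-- The set of continuous functions between two represented spaces. -/
def ContFun {X Y : Type*} (δX : Representation X) (δY : Representation Y) : Type _ :=
  {g : X → Y // IsContinuousFun δX δY g}

/-- The canonical function space representation `[δX → δY]`: `q` is a name of `g` if and only if
`η_q` is a realizer of `g`. -/
def funRep {X Y : Type*} (δX : Representation X) (δY : Representation Y) :
    Representation (ContFun δX δY) where
  IsName q g := Realizes δX δY (eta q) fun x => {g.1 x}
  unique := by
    intro q g g' hg hg'
    apply Subtype.ext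
    funext x
    obtain ⟨p, hp⟩ := δX.surj x
    obtain ⟨r, hr, y, hy, hyg⟩ := hg p x hp (Set.singleton_nonempty _)
    obtain ⟨r', hr', y', hy', hyg'⟩ := hg' p x hp (Set.singleton_nonempty _)
    obtain rfl := Part.mem_unique hr hr'
    obtain rfl := δY.unique hy hy'
    exact (Set.mem_singleton_iff.1 hyg).symm.trans (Set.mem_singleton_iff.1 hyg')
  surj := by
    rintro ⟨g, F, hF, hFg⟩
    obtain ⟨q, hq⟩ := exists_eta_extends hF
    refine ⟨q, fun p x hp hx => ?_⟩
    obtain ⟨r, hr, y, hy, hyg⟩ := hFg p x hp hx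
    exact ⟨r, hq p r hr, y, hy, hyg⟩

/-! ### Sierpiński space, open and closed sets -/

/-- Sierpiński space `{0, 1}` is `Prop`, with `0 = False` and `1 = True`. Its representation is
total: `p` is a name of `1` if and only if `p n = 0` for some `n`. -/
def sierpinski : Representation Prop where
  IsName p s := s ↔ ∃ n, p n = 0
  unique h h' := propext (h.trans h'.symm)
  surj s := by
    by_cases hs : s
    · exact ⟨fun _ => 0, iff_of_true hs ⟨0, rfl⟩⟩
    · exact ⟨fun _ => 1, iff_of_false hs fun ⟨_, h⟩ => one_ne_zero h⟩

/-- The characteristic function of `U ⊆ X`, with values in Sierpiński space. -/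
def chi {X : Type*} (U : Set X) : X → Prop := fun x => x ∈ U

/-- A subset of a represented space is open if its characteristic function is continuous. -/
def IsOpenSet {X : Type*} (δ : Representation X) (U : Set X) : Prop :=
  IsContinuousFun δ sierpinski (chi U)

/-- The hyperspace of closed subsets of a represented space. -/
def ClosedSets {X : Type*} (δ : Representation X) : Type _ :=
  {A : Set X // IsOpenSet δ Aᶜ}

/-- The characteristic function of the complement of a closed set, as a continuous function. -/
def ClosedSets.chiCompl {X : Type*} {δ : Representation X} (A : ClosedSets δ) :
    ContFun δ sierpinski :=
  ⟨chi (A.1)ᶜ, A.2⟩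

/-- The negative information representation of the closed sets: a name of `A` is a name of the
characteristic function of the complement of `A`. -/
def negRep {X : Type*} (δ : Representation X) : Representation (ClosedSets δ) where
  IsName p A := (funRep δ sierpinski).IsName p A.chiCompl
  unique := by
    intro p A B hA hB
    have h := congrArg Subtype.val ((funRep δ sierpinski).unique hA hB)
    exact Subtype.ext (compl_injective h)
  surj A := (funRep δ sierpinski).surj A.chiCompl

/-- Closed choice `C_X :⊆ 𝒜₋(X) ⇉ X, A ↦ A`, whose domain consists of the non-empty closed
sets. -/
def closedChoice {X : Type*} (δ : Representation X) : ClosedSets δ → Set X := fun A => A.1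

/-- A subset of Baire space as a represented space: the representation is the restriction of the
identity. -/
def subspaceRep (A : Set Baire) : Representation A where
  IsName p a := p = a.1
  unique h h' := Subtype.ext (h.symm.trans h')
  surj a := ⟨a.1, rfl⟩

/-! ### Non-deterministic computability -/

/-- `f :⊆ (X, δX) ⇉ (Y, δY)` is non-deterministically computable with advice space `A`: there are
computable `F₁, F₂` such that, for all `p ∈ dom (f ∘ δX)`, `⟨p, r⟩ ∈ dom F₂` for all `r ∈ A`, some
`r ∈ A` is successful (the element of Sierpiński space with name `F₂⟨p, r⟩` is `0`), and
`F₁⟨p, r⟩` is a name of an element of `f (δX p)` for all successful `r ∈ A`. -/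
def NonDetComputable {X Y : Type*} (δX : Representation X) (δY : Representation Y)
    (A : Set Baire) (f : X → Set Y) : Prop :=
  ∃ F₁ F₂ : Baire →. Baire, IsComputable F₁ ∧ IsComputable F₂ ∧
    ∀ p x, δX.IsName p x → x ∈ mdom f →
      (∀ r ∈ A, pairing p r ∈ F₂.Dom) ∧
      (∃ r ∈ A, ∃ s ∈ F₂ (pairing p r), sierpinski.IsName s False) ∧
      (∀ r ∈ A, (∃ s ∈ F₂ (pairing p r), sierpinski.IsName s False) →
        ∃ q ∈ F₁ (pairing p r), ∃ y, δY.IsName q y ∧ y ∈ f x)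

end TTE

namespace TTE

/-! ### Closure properties of the recursive functionals -/

/-! A name of a closed set `B ⊆ A` is a procedure that recognizes the points outside `B`, and that
is also what a failure test for advice does: with `p` fixed, the `r` for which `F₂⟨p, r⟩` names `0`
form a closed subset of `A`.

Given a reduction `K`, `H`, put `F₁ = K` and `F₂⟨p, r⟩ = η_{H p}(r)`, computable by
`RecFunctional.evalFunctional`. The successful advice is then the set `B` named by `H p`. Since the
reduction works for every realizer of closed choice, any `r ∈ B` may be taken as the answer at `H p`
(`Realizes.update_closedChoice`), so `K⟨p, r⟩` is correct.

Conversely put `K = F₁` and let `H p` be a name of the set of successful advice. This needs a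
computable currying of `F₂` into total tables. By `RecFunctional.exists_approximates` the machine
for `F₂` has primitive recursive finite-stage approximations; `adviceTable` dovetails positions and
stages, and `exists_adviceName_eq_zero_iff` shows that failure is preserved. -/

theorem RecFunctional.of_natPrimrec {g : ℕ → ℕ} (hg : Nat.Primrec g) :
    RecFunctional fun _ n => Part.some (g n) := by
  induction hg with
  | zero => exact .zero
  | succ => exact .succ
  | left => exact .left
  | right => exact .right
  | pair _ _ hf hg => simpa using hf.pair hg
  | comp _ _ hf hg => simpa using hf.comp hg
  | @prec f g _ _ hf hg =>
    refine cast (congrArg RecFunctional ?_) (hf.prec hg)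
    funext p n
    simp only [Nat.unpaired]
    induction n.unpair.2 with
    | zero => rfl
    | succ y ih => simp [ih]

/-- Substitution of an oracle that is computed from another oracle. -/
theorem RecFunctional.subst {e : Baire → Baire}
    (he : RecFunctional fun s n => Part.some (e s n)) {Φ : Baire → ℕ →. ℕ}
    (hΦ : RecFunctional Φ) : RecFunctional fun s n => Φ (e s) n := by
  induction hΦ with
  | zero => exact .zero
  | succ => exact .succ
  | left => exact .left
  | right => exact .right
  | oracle => exact he
  | pair _ _ h₁ h₂ => exact h₁.pair h₂
  | comp _ _ h₁ h₂ => exact h₁.comp h₂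
  | prec _ _ h₁ h₂ => exact h₁.prec h₂
  | rfind _ h => exact h.rfind

/-- Total functions of an oracle and a number, with values in an encodable type, which are
computable uniformly in the oracle. -/
def TotalRec {σ : Type*} [Primcodable σ] (c : Baire → ℕ → σ) : Prop :=
  RecFunctional fun p n => Part.some (Encodable.encode (c p n))

namespace TotalRec

variable {α β σ : Type*} [Primcodable α] [Primcodable β] [Primcodable σ]

theorem id : TotalRec fun _ n => n := .of_natPrimrec (Primrec.nat_iff.1 Primrec.id)

theorem oracle : TotalRec fun p n => p n := RecFunctional.oracle

theorem comp {f : Baire → ℕ → σ} {g : Baire → ℕ → ℕ} (hf : TotalRec f) (hg : TotalRec g) :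
    TotalRec fun p n => f p (g p n) := by
  simpa [TotalRec] using RecFunctional.comp hf hg

theorem pair {f : Baire → ℕ → α} {g : Baire → ℕ → β} (hf : TotalRec f) (hg : TotalRec g) :
    TotalRec fun p n => (f p n, g p n) := by
  simpa [TotalRec] using RecFunctional.pair hf hg

theorem map {F : α → σ} (hF : Primrec F) {f : Baire → ℕ → α} (hf : TotalRec f) :
    TotalRec fun p n => F (f p n) := by
  -- `Primrec F` speaks of codes in `Option σ`, where `some` adds one to the code; `pred` removes
  -- this shift.
  have h : RecFunctional fun _ n =>
      Part.some (Encodable.encode ((Encodable.decode (α := α) n).map F)).pred :=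
    .of_natPrimrec (Nat.Primrec.pred.comp hF)
  simpa [TotalRec] using RecFunctional.comp h hf

theorem of_primrec {F : ℕ → σ} (hF : Primrec F) : TotalRec fun _ n => F n := id.map hF

theorem recFunctional_comp {Φ : Baire → ℕ →. ℕ} {g : Baire → ℕ → α} (hΦ : RecFunctional Φ)
    (hg : TotalRec g) : RecFunctional fun p n => Φ p (Encodable.encode (g p n)) := by
  simpa using hΦ.comp hg

end TotalRec

/-- The first `k` entries of `p`. -/
def initSeg (p : Baire) (k : ℕ) : List ℕ := (List.range k).map p

@[simp] theorem length_initSeg (p : Baire) (k : ℕ) : (initSeg p k).length = k := by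
  simp [initSeg]

theorem getElem?_initSeg {p : Baire} {k i : ℕ} (h : i < k) : (initSeg p k)[i]? = some (p i) := by
  simp [initSeg, h]

theorem initSeg_succ (p : Baire) (k : ℕ) : initSeg p (k + 1) = initSeg p k ++ [p k] := by
  simp [initSeg, List.range_succ]

theorem totalRec_initSeg : TotalRec initSeg := by
  have hstep : TotalRec fun p m =>
      ((Encodable.decode (α := List ℕ) m.unpair.2.unpair.2).getD []) ++ [p m.unpair.2.unpair.1] := by
    have h1 : TotalRec fun _ m => (Encodable.decode (α := List ℕ) m.unpair.2.unpair.2).getD [] :=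
      .of_primrec (Primrec.option_getD.comp (Primrec.decode.comp
        (Primrec.snd.comp (Primrec.unpair.comp (Primrec.snd.comp Primrec.unpair))))
        (Primrec.const []))
    have h2 : TotalRec fun p m => p m.unpair.2.unpair.1 :=
      TotalRec.oracle.comp (.of_primrec
        (Primrec.fst.comp (Primrec.unpair.comp (Primrec.snd.comp Primrec.unpair))))
    exact (h1.pair h2).map Primrec.list_concat
  -- The base value `0` is the code of the empty list; the parameter of the recursion is a dummy,
  -- set to `0` below.
  have hrec := RecFunctional.zero.prec hstep
  have hz : TotalRec fun _ n => (0, n) := .of_primrec ((Primrec.const 0).pair Primrec.id)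
  refine cast (congrArg RecFunctional ?_) (hz.recFunctional_comp hrec)
  funext p n
  simp only [Encodable.encode_prod_val, Encodable.encode_nat, Nat.unpair_pair]
  induction n with
  | zero => rfl
  | succ k ih =>
    rw [initSeg_succ]
    refine (congrArg (Part.bind · _) ih).trans ?_
    simp

/-! ### Primitive recursive approximations of recursive functionals -/

/-- `A` approximates `Φ` by evaluations that see only a finite part of the oracle. -/
structure Approximates (A : List ℕ → ℕ → Option ℕ) (Φ : Baire → ℕ →. ℕ) : Prop where
  primrec : Primrec₂ A
  sound : ∀ {s k n v}, A (initSeg s k) n = some v → v ∈ Φ s n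
  complete : ∀ {s n v}, v ∈ Φ s n → ∀ᶠ k in Filter.atTop, A (initSeg s k) n = some v

namespace Approximates

open Filter

theorem of_primrec {g : ℕ → ℕ} (hg : Primrec g) :
    Approximates (fun _ n => some (g n)) fun _ n => Part.some (g n) where
  primrec := Primrec.option_some.comp (hg.comp Primrec.snd)
  sound h := by simpa [eq_comm] using h
  complete h := .of_forall fun _ => congrArg some (Part.mem_some_iff.1 h).symm

theorem oracle : Approximates (fun w n => w[n]?) fun p n => Part.some (p n) where
  primrec := Primrec.list_getElem?
  sound {s k n v} h := by
    have hn : n < k := by simpa using (List.getElem?_eq_some_iff.1 h).1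
    simpa [getElem?_initSeg hn, eq_comm] using h
  complete {s n v} h := by
    filter_upwards [eventually_gt_atTop n] with k hk
    simpa [getElem?_initSeg hk, eq_comm] using h

variable {A B : List ℕ → ℕ → Option ℕ} {Φ Ψ : Baire → ℕ →. ℕ}

theorem pair (hA : Approximates A Φ) (hB : Approximates B Ψ) :
    Approximates (fun w n => (A w n).bind fun a => (B w n).map fun b => Nat.pair a b)
      fun p n => (Φ p n).bind fun a => (Ψ p n).map fun b => Nat.pair a b where
  primrec := Primrec.option_bind hA.primrec
    (Primrec.option_map (hB.primrec.comp (Primrec.fst.comp Primrec.fst)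
        (Primrec.snd.comp Primrec.fst))
      (Primrec₂.natPair.comp (Primrec.snd.comp Primrec.fst) Primrec.snd))
  sound h := by
    obtain ⟨a, ha, h⟩ := Option.bind_eq_some_iff.1 h
    obtain ⟨b, hb, rfl⟩ := Option.map_eq_some_iff.1 h
    exact Part.mem_bind (hA.sound ha) (Part.mem_map _ (hB.sound hb))
  complete h := by
    obtain ⟨a, ha, h⟩ := Part.mem_bind_iff.1 h
    obtain ⟨b, hb, rfl⟩ := (Part.mem_map_iff _).1 h
    filter_upwards [hA.complete ha, hB.complete hb] with k h₁ h₂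
    simp [h₁, h₂]

theorem comp (hA : Approximates A Φ) (hB : Approximates B Ψ) :
    Approximates (fun w n => (B w n).bind fun a => A w a)
      fun p n => (Ψ p n).bind fun a => Φ p a where
  primrec := Primrec.option_bind hB.primrec
    (hA.primrec.comp (Primrec.fst.comp Primrec.fst) Primrec.snd)
  sound h := by
    obtain ⟨a, ha, h⟩ := Option.bind_eq_some_iff.1 h
    exact Part.mem_bind (hB.sound ha) (hA.sound h)
  complete h := by
    obtain ⟨a, ha, h⟩ := Part.mem_bind_iff.1 h
    filter_upwards [hB.complete ha, hA.complete h] with k h₁ h₂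
    simp [h₁, h₂]

theorem prec (hA : Approximates A Φ) (hB : Approximates B Ψ) :
    Approximates
      (fun w m => Nat.rec (motive := fun _ => Option ℕ) (A w m.unpair.1)
        (fun y IH => IH.bind fun i => B w (Nat.pair m.unpair.1 (Nat.pair y i))) m.unpair.2)
      (fun p m => Nat.rec (motive := fun _ => Part ℕ) (Φ p m.unpair.1)
        (fun y IH => IH.bind fun i => Ψ p (Nat.pair m.unpair.1 (Nat.pair y i))) m.unpair.2) where
  primrec := by
    have h1 : Primrec fun a : List ℕ × ℕ => a.2.unpair.1 :=
      Primrec.fst.comp (Primrec.unpair.comp Primrec.snd)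
    have h2 : Primrec fun a : List ℕ × ℕ => a.2.unpair.2 :=
      Primrec.snd.comp (Primrec.unpair.comp Primrec.snd)
    refine Primrec.nat_rec' (h := fun (a : List ℕ × ℕ) (b : ℕ × Option ℕ) =>
      b.2.bind fun i => B a.1 (Nat.pair a.2.unpair.1 (Nat.pair b.1 i)))
      h2 (hA.primrec.comp Primrec.fst h1) ?_
    refine Primrec.option_bind (Primrec.snd.comp Primrec.snd) ?_
    refine hB.primrec.comp (Primrec.fst.comp (Primrec.fst.comp Primrec.fst)) ?_
    exact Primrec₂.natPair.comp (h1.comp (Primrec.fst.comp Primrec.fst))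
      (Primrec₂.natPair.comp (Primrec.fst.comp (Primrec.snd.comp Primrec.fst)) Primrec.snd)
  sound {s k n v} h := by
    generalize n.unpair.2 = m at h ⊢
    induction m generalizing v with
    | zero => exact hA.sound h
    | succ y ih =>
      obtain ⟨a, ha, h⟩ := Option.bind_eq_some_iff.1 h
      exact Part.mem_bind (ih ha) (hB.sound h)
  complete {s n v} h := by
    generalize n.unpair.2 = m at h ⊢
    induction m generalizing v with
    | zero => exact hA.complete h
    | succ y ih =>
      obtain ⟨a, ha, h⟩ := Part.mem_bind_iff.1 h
      filter_upwards [ih ha, hB.complete h] with k h₁ h₂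
      simp [h₁, h₂]

/-- The search for the least zero of a partial function, bounded by `k`. -/
def boundedSearch (f : ℕ → Option ℕ) (k : ℕ) : Option ℕ :=
  let l := (List.range k).map f
  -- With the default `0` the search also halts at an undefined value; the next line then returns
  -- `none`.
  let i := l.findIdx fun o => o.getD 0 == 0
  l[i]?.bind fun o => o.map fun _ => i

theorem boundedSearch_eq_some {f : ℕ → Option ℕ} {k v : ℕ} :
    boundedSearch f k = some v ↔
      v < k ∧ f v = some 0 ∧ ∀ j < v, ∃ u, f j = some u ∧ u ≠ 0 := by
  have hp : ∀ o : Option ℕ, (o.getD 0 == 0) = false ↔ ∃ u, o = some u ∧ u ≠ 0 := by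
    rintro (_ | u) <;> simp
  simp only [boundedSearch, Option.bind_eq_some_iff, Option.map_eq_some_iff]
  constructor
  · rintro ⟨o, ho, u, rfl, hv⟩
    rw [hv] at ho
    have hvk : v < k := by simpa using (List.getElem?_eq_some_iff.1 ho).1
    have hfv : f v = some u := by simpa [hvk] using ho
    obtain ⟨h₁, h₂⟩ := (List.findIdx_eq (by simpa using hvk)).1 hv
    simp only [List.getElem_map, List.getElem_range] at h₁ h₂
    have hu : u = 0 := by simpa [hfv] using h₁
    exact ⟨hvk, hu ▸ hfv, fun j hj => (hp _).1 (h₂ j hj)⟩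
  · rintro ⟨hvk, hfv, hlt⟩
    have hi : ((List.range k).map f).findIdx (fun o => o.getD 0 == 0) = v := by
      refine (List.findIdx_eq (by simpa using hvk)).2 ?_
      simp only [List.getElem_map, List.getElem_range]
      exact ⟨by simp [hfv], fun j hj => (hp _).2 (hlt j hj)⟩
    rw [hi]
    exact ⟨some 0, by simp [hvk, hfv], 0, rfl, rfl⟩

theorem rfind (hA : Approximates A Φ) :
    Approximates (fun w a => boundedSearch (fun n => A w (Nat.pair a n)) w.length)
      fun p a => Nat.rfind fun n => (Φ p (Nat.pair a n)).map fun m => decide (m = 0) where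
  primrec := by
    have hl : Primrec fun x : List ℕ × ℕ =>
        (List.range x.1.length).map fun n => A x.1 (Nat.pair x.2 n) :=
      Primrec.list_map (Primrec.list_range.comp (Primrec.list_length.comp Primrec.fst))
        (hA.primrec.comp (Primrec.fst.comp Primrec.fst)
          (Primrec₂.natPair.comp (Primrec.snd.comp Primrec.fst) Primrec.snd))
    have hi : Primrec fun x : List ℕ × ℕ =>
        ((List.range x.1.length).map fun n => A x.1 (Nat.pair x.2 n)).findIdx
          fun o => o.getD 0 == 0 :=
      Primrec.list_findIdx hl (Primrec.beq.comp
        (Primrec.option_getD.comp Primrec.snd (Primrec.const 0)) (Primrec.const 0))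
    exact Primrec.option_bind (Primrec.list_getElem?.comp hl hi)
      (Primrec.option_map Primrec.snd (hi.comp (Primrec.fst.comp Primrec.fst)))
  sound h := by
    obtain ⟨-, h0, hlt⟩ := boundedSearch_eq_some.1 h
    refine Nat.mem_rfind.2 ⟨(Part.mem_map_iff _).2 ⟨0, hA.sound h0, by simp⟩, fun {j} hj => ?_⟩
    obtain ⟨u, hu, hne⟩ := hlt j hj
    exact (Part.mem_map_iff _).2 ⟨u, hA.sound hu, by simpa using hne⟩
  complete {s n v} h := by
    obtain ⟨h0, hlt⟩ := Nat.mem_rfind.1 h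
    obtain ⟨u, hu, hu0⟩ := (Part.mem_map_iff _).1 h0
    obtain rfl : u = 0 := by simpa using hu0
    -- The finitely many values below `v` are all found from some common stage on.
    have hev : ∀ᶠ k in atTop, ∀ j ∈ Finset.range v,
        ∃ u, A (initSeg s k) (Nat.pair n j) = some u ∧ u ≠ 0 := by
      refine (Finset.eventually_all _).2 fun j hj => ?_
      obtain ⟨u, hu, hu0⟩ := (Part.mem_map_iff _).1 (hlt (Finset.mem_range.1 hj))
      filter_upwards [hA.complete hu] with k hk
      exact ⟨u, hk, by simpa using hu0⟩
    filter_upwards [eventually_gt_atTop v, hA.complete hu, hev] with k hk h₁ h₂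
    exact boundedSearch_eq_some.2
      ⟨by simpa using hk, h₁, fun j hj => h₂ j (Finset.mem_range.2 hj)⟩

end Approximates

/-- A halting computation reads only finitely much of the oracle. Asking for completeness at all
large stages, not just at one, allows the subcomputations to be combined at a common stage. -/
theorem RecFunctional.exists_approximates {Φ : Baire → ℕ →. ℕ} (hΦ : RecFunctional Φ) :
    ∃ A, Approximates A Φ := by
  induction hΦ with
  | zero => exact ⟨_, .of_primrec (Primrec.const 0)⟩
  | succ => exact ⟨_, .of_primrec Primrec.succ⟩
  | left => exact ⟨_, .of_primrec (Primrec.fst.comp Primrec.unpair)⟩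
  | right => exact ⟨_, .of_primrec (Primrec.snd.comp Primrec.unpair)⟩
  | oracle => exact ⟨_, .oracle⟩
  | pair _ _ h₁ h₂ => exact h₁.elim fun _ h₁ => h₂.elim fun _ h₂ => ⟨_, h₁.pair h₂⟩
  | comp _ _ h₁ h₂ => exact h₁.elim fun _ h₁ => h₂.elim fun _ h₂ => ⟨_, h₁.comp h₂⟩
  | prec _ _ h₁ h₂ => exact h₁.elim fun _ h₁ => h₂.elim fun _ h₂ => ⟨_, h₁.prec h₂⟩
  | rfind _ h => exact h.elim fun _ h => ⟨_, h.rfind⟩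

/-! ### Pairings -/

/-- The entries of `p` with even index. -/
def evenPart (s : Baire) : Baire := fun n => s (2 * n)

/-- The entries of `p` with odd index. -/
def oddPart (s : Baire) : Baire := fun n => s (2 * n + 1)

@[simp] theorem evenPart_pairing (p r : Baire) : evenPart (pairing p r) = p := by
  funext n; simp [evenPart, pairing]

@[simp] theorem oddPart_pairing (p r : Baire) : oddPart (pairing p r) = r := by
  funext n
  have h : (2 * n + 1) / 2 = n := by omega
  simp [oddPart, pairing, h]

theorem totalRec_evenPart : TotalRec evenPart :=
  TotalRec.oracle.comp (.of_primrec Primrec.nat_double)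

theorem totalRec_oddPart : TotalRec oddPart :=
  TotalRec.oracle.comp (.of_primrec Primrec.nat_double_succ)

/-- The first `w.length` entries of `⟨p, r⟩`, computed from initial segments of `p` and `r`. -/
def interleave (P w : List ℕ) : List ℕ :=
  (List.range w.length).map fun i => if i % 2 = 0 then P.getD (i / 2) 0 else w.getD (i / 2) 0

/-- Entry `i` of the pairing needs only entry `i / 2` of one component, so for `i < n` the default
values are never read. -/
theorem interleave_initSeg {p r : Baire} {m n : ℕ} (h : n ≤ m) :
    interleave (initSeg p m) (initSeg r n) = initSeg (pairing p r) n := by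
  simp only [interleave, length_initSeg]
  refine List.map_congr_left fun i hi => ?_
  have hi : i < n := List.mem_range.1 hi
  simp only [pairing, List.getD_eq_getElem?_getD]
  rw [getElem?_initSeg (by omega), getElem?_initSeg (by omega)]
  rfl

theorem primrec_interleave : Primrec₂ interleave := by
  refine Primrec.list_map (Primrec.list_range.comp (Primrec.list_length.comp Primrec.snd)) ?_
  have hd : Primrec fun x : (List ℕ × List ℕ) × ℕ => x.2 / 2 :=
    Primrec.nat_div.comp Primrec.snd (Primrec.const 2)
  exact Primrec.ite
    (Primrec.eq.comp (Primrec.nat_mod.comp Primrec.snd (Primrec.const 2)) (Primrec.const 0))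
    ((Primrec.list_getD 0).comp (Primrec.fst.comp Primrec.fst) hd)
    ((Primrec.list_getD 0).comp (Primrec.snd.comp Primrec.fst) hd)

/-! ### The evaluation of `η` is computable -/

/-- `⟨p, r⟩ ↦ η_{H p}(r)`, where `H` is the functional given by `Φ`. -/
def evalFunctional (Φ : Baire → ℕ →. ℕ) : Baire → ℕ →. ℕ := fun s n =>
  -- `RecFunctional.rfind` looks for zeros, whereas the first nonzero table entry is wanted;
  -- truncated subtraction gives `1 - m = 0` exactly for `m ≠ 0`. The final `Nat.pred` decodes the
  -- entry `m + 1` as `m`.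
  (Nat.rfind fun k => (Φ (evenPart s) (Encodable.encode (initSeg (oddPart s) k, n))).map
    fun m => decide (1 - m = 0)).bind fun k =>
      (Φ (evenPart s) (Encodable.encode (initSeg (oddPart s) k, n))).map Nat.pred

theorem RecFunctional.evalFunctional {Φ : Baire → ℕ →. ℕ} (hΦ : RecFunctional Φ) :
    RecFunctional (evalFunctional Φ) := by
  have harg : TotalRec fun s m => (initSeg (oddPart s) m.unpair.2, m.unpair.1) := by
    have h : TotalRec fun s n => initSeg (oddPart s) n :=
      RecFunctional.subst totalRec_oddPart (show RecFunctional _ from totalRec_initSeg)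
    exact (h.comp (.of_primrec (Primrec.snd.comp Primrec.unpair))).pair
      (.of_primrec (Primrec.fst.comp Primrec.unpair))
  have hq : RecFunctional fun s m => Φ (evenPart s)
      (Encodable.encode (initSeg (oddPart s) m.unpair.2, m.unpair.1)) :=
    harg.recFunctional_comp (RecFunctional.subst totalRec_evenPart hΦ)
  have hsub : RecFunctional fun _ n => Part.some (1 - n) :=
    .of_natPrimrec (Primrec.nat_iff.1 (Primrec.nat_sub.comp (Primrec.const 1) Primrec.id))
  have hpred : RecFunctional fun _ n => Part.some n.pred := .of_natPrimrec Nat.Primrec.pred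
  refine cast (congrArg RecFunctional ?_)
    (hpred.comp (hq.comp ((show RecFunctional _ from TotalRec.id).pair (hsub.comp hq).rfind)))
  funext s n
  simp [TTE.evalFunctional, Part.bind_some_eq_map, Part.bind_map, Part.map_map, Function.comp_def]
  rfl

theorem mem_evalFunctional {Φ : Baire → ℕ →. ℕ} {p q r : Baire} (hq : ∀ n, q n ∈ Φ p n) {n v : ℕ}
    (hv : v ∈ evalAt q r n) : v ∈ evalFunctional Φ (pairing p r) n := by
  have hΦ : ∀ n, Φ p n = Part.some (q n) := fun n => Part.eq_some_iff.2 (hq n)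
  obtain ⟨k, hk, hv⟩ := Part.mem_bind_iff.1 hv
  obtain ⟨hk₁, hk₂⟩ := Nat.mem_rfind.1 hk
  have hv : q (Encodable.encode ((List.range k).map r, n)) = v + 1 := 
    ppred_eq_some.1 (Part.mem_coe.1 hv)
  simp only [evalFunctional, evenPart_pairing, oddPart_pairing, hΦ, Part.map_some]
  refine Part.mem_bind_iff.2 ⟨k, Nat.mem_rfind.2 ⟨?_, fun {j} hj => ?_⟩, ?_⟩
  · simp only [initSeg, hv]
    simp
  · have h0 : ∀ m : ℕ, m.ppred.isSome = false → m = 0 := by rintro (_ | m) h <;> simp_all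
    have h : q (Encodable.encode ((List.range j).map r, n)) = 0 :=
      h0 _ (Part.mem_some_iff.1 (hk₂ hj)).symm
    simp only [initSeg, h]
    simp
  · simp only [initSeg, hv]
    simp

/-! ### From reductions to advice -/

/-- Closed choice has a realizer that is defined only on names of non-empty closed sets. -/
theorem exists_realizes_closedChoice (A : Set Baire) :
    ∃ G : Baire →. Baire,
      Realizes (negRep (subspaceRep A)) (subspaceRep A) G (closedChoice (subspaceRep A)) ∧
      ∀ q, ∀ r ∈ G q, ∃ B : ClosedSets (subspaceRep A),
        (negRep (subspaceRep A)).IsName q B ∧ B.1.Nonempty := by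
  let S : Baire → Set A := fun q => {a | ∃ B : ClosedSets (subspaceRep A),
    (negRep (subspaceRep A)).IsName q B ∧ a ∈ B.1}
  refine ⟨fun q => ⟨(S q).Nonempty, fun h => h.some.1⟩, ?_, ?_⟩
  · rintro q B hB ⟨b, hb⟩
    have hne : (S q).Nonempty := ⟨b, B, hB, hb⟩
    obtain ⟨B', hB', ha⟩ := hne.some_mem
    obtain rfl := (negRep (subspaceRep A)).unique hB hB'
    exact ⟨_, ⟨hne, rfl⟩, hne.some, rfl, ha⟩
  · rintro q _ ⟨⟨a, B, hB, ha⟩, -⟩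
    exact ⟨B, hB, a, ha⟩

open Classical in
/-- The value of a realizer of closed choice at a name of a closed set can be changed to any element
of that set. -/
theorem Realizes.update_closedChoice {A : Set Baire} {G : Baire →. Baire}
    (hG : Realizes (negRep (subspaceRep A)) (subspaceRep A) G (closedChoice (subspaceRep A)))
    {q : Baire} {B : ClosedSets (subspaceRep A)} (hB : (negRep (subspaceRep A)).IsName q B)
    {a : A} (ha : a ∈ B.1) :
    Realizes (negRep (subspaceRep A)) (subspaceRep A) (fun q' => if q' = q then Part.some a.1 else G q')
      (closedChoice (subspaceRep A)) := by
  intro q' B' hB' hne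
  by_cases h : q' = q
  · subst h
    obtain rfl := (negRep (subspaceRep A)).unique hB hB'
    exact ⟨a.1, by simp, a, rfl, ha⟩
  · simpa [h] using hG q' B' hB' hne

theorem nonDetComputable_of_weihrauchReducible {X Y : Type*} {δX : Representation X}
    {δY : Representation Y} {A : Set Baire} {f : X → Set Y}
    (h : WeihrauchReducible δX δY (negRep (subspaceRep A)) (subspaceRep A) f
      (closedChoice (subspaceRep A))) : NonDetComputable δX δY A f := by
  obtain ⟨K, H, hK, ⟨Φ, hΦ, hHΦ⟩, hred⟩ := h
  obtain ⟨G, hG, hGdom⟩ := exists_realizes_closedChoice A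
  refine ⟨K, fun s => sequenceOf (evalFunctional Φ s), hK, ⟨_, hΦ.evalFunctional, fun _ => rfl⟩,
    fun p x hp hx => ?_⟩
  obtain ⟨q, hq, B, hB, hne⟩ : ∃ q ∈ H p, ∃ B : ClosedSets (subspaceRep A),
      (negRep (subspaceRep A)).IsName q B ∧ B.1.Nonempty := by
    -- The composition is defined at `p`, so `G` is defined at `H p`; by the choice of `G`, this
    -- forces `H p` to be a name of a non-empty closed set.
    obtain ⟨z, hz, -⟩ := hred G hG p x hp hx
    obtain ⟨q, hq, hz⟩ := Part.mem_bind_iff.1 hz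
    obtain ⟨r, hr, -⟩ := Part.mem_bind_iff.1 hz
    exact ⟨q, hq, hGdom q r hr⟩
  have hqΦ : ∀ n, q n ∈ Φ p n := mem_sequenceOf.1 (hHΦ p ▸ hq)
  have hF₂ : ∀ r (hr : r ∈ A), ∃ s ∈ sequenceOf (evalFunctional Φ (pairing p r)),
      (sierpinski.IsName s False ↔ ⟨r, hr⟩ ∈ B.1) := by
    intro r hr
    obtain ⟨s, hs, y, hy, hyB⟩ := hB r ⟨r, hr⟩ rfl (Set.singleton_nonempty _)
    refine ⟨s, mem_sequenceOf.2 fun n => mem_evalFunctional hqΦ (mem_sequenceOf.1 hs n), ?_⟩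
    obtain rfl : y = (⟨r, hr⟩ ∈ (B.1)ᶜ) := hyB
    constructor
    · intro h
      have := sierpinski.unique hy h
      simpa using this
    · intro h
      convert hy
      simpa using h
  refine ⟨fun r hr => ?_, ?_, ?_⟩
  · obtain ⟨s, hs, -⟩ := hF₂ r hr
    exact hs.1
  · obtain ⟨⟨r, hr⟩, hrB⟩ := hne
    obtain ⟨s, hs, h⟩ := hF₂ r hr
    exact ⟨r, hr, s, hs, h.2 hrB⟩
  · rintro r hr ⟨s, hs, hs0⟩
    obtain ⟨s', hs', h⟩ := hF₂ r hr
    obtain rfl := Part.mem_unique hs hs'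
    have hrB := h.1 hs0
    -- The reduction is applied to a realizer that answers the given advice `r` at `q = H p`.
    obtain ⟨z, hz, y, hy, hyf⟩ := hred _ (hG.update_closedChoice hB hrB) p x hp hx
    obtain ⟨q', hq', hzq⟩ := Part.mem_bind_iff.1 hz
    obtain rfl := Part.mem_unique hq hq'
    obtain ⟨r', hr', hzr⟩ := Part.mem_bind_iff.1 hzq
    obtain rfl : r' = r := by simpa using hr'
    exact ⟨z, hzr, y, hy, hyf⟩

/-! ### The closed set of successful advice -/

/-- The table of a machine that, on input `r`, writes a zero if and only if the approximation `A`
finds a zero in the output on `⟨p, r⟩`; here `P` is an initial segment of `p`. -/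
def adviceTable (A : List ℕ → ℕ → Option ℕ) (P : List ℕ) (c : ℕ) : ℕ :=
  ((Encodable.decode (α := List ℕ × ℕ) c).map fun x =>
    -- Output entry `n` codes a position `n.unpair.1` and is decided after exactly `n` entries of
    -- `r`. Table entries `1` and `2` stand for the outputs `0` and `1`; the entry `0` asks for more
    -- input.
    if x.1.length = x.2 then
      if A (interleave P x.1) x.2.unpair.1 = some 0 then 1 else 2
    else 0).getD 0

theorem primrec_adviceTable {A : List ℕ → ℕ → Option ℕ} (hA : Primrec₂ A) :
    Primrec₂ (adviceTable A) := by
  refine Primrec.option_getD.comp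
    (Primrec.option_map (Primrec.decode.comp Primrec.snd) ?_) (Primrec.const 0)
  have hw : Primrec fun x : (List ℕ × ℕ) × (List ℕ × ℕ) => x.2.1 := Primrec.fst.comp Primrec.snd
  have hn : Primrec fun x : (List ℕ × ℕ) × (List ℕ × ℕ) => x.2.2 := Primrec.snd.comp Primrec.snd
  refine Primrec.ite (Primrec.eq.comp (Primrec.list_length.comp hw) hn) (Primrec.ite
    (Primrec.eq.comp (hA.comp (primrec_interleave.comp (Primrec.fst.comp Primrec.fst) hw)
      (Primrec.fst.comp (Primrec.unpair.comp hn))) (Primrec.const (some 0)))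
    (Primrec.const 1) (Primrec.const 2)) (Primrec.const 0)

/-- The code `c` of a pair `(w, n)` is at least `n`, so the first `c` entries of `p` are enough to
fill in table entry `c`. -/
theorem adviceTable_initSeg (A : List ℕ → ℕ → Option ℕ) (p r : Baire) (k n : ℕ) :
    adviceTable A (initSeg p (Encodable.encode (initSeg r k, n)))
        (Encodable.encode (initSeg r k, n)) =
      if k = n then if A (initSeg (pairing p r) n) n.unpair.1 = some 0 then 1 else 2 else 0 := by
  have hle : n ≤ Encodable.encode (initSeg r k, n) := Nat.right_le_pair _ _
  rw [adviceTable, Encodable.encodek]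
  simp only [Option.map_some, Option.getD_some, length_initSeg]
  by_cases h : k = n
  · subst h
    rw [interleave_initSeg hle]
  · simp only [if_neg h]

/-- The name in Sierpiński space which is computed by `adviceTable`. -/
def adviceName (A : List ℕ → ℕ → Option ℕ) (p r : Baire) : Baire := fun n =>
  if A (initSeg (pairing p r) n) n.unpair.1 = some 0 then 0 else 1

/-- For each `n` only the prefix of length `k = n` has a nonzero table entry, so the search has a
unique answer. No hypothesis on `r` is needed: the table yields a full sequence even where the
approximated functional is undefined. -/
theorem adviceName_mem_eta (A : List ℕ → ℕ → Option ℕ) (p r : Baire) :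
    adviceName A p r ∈ eta (fun c => adviceTable A (initSeg p c) c) r := by
  refine mem_sequenceOf.2 fun n => evalAt_eq (fun k m h => ?_) ⟨n, adviceName A p r n, ?_⟩
  · rw [← initSeg, adviceTable_initSeg] at h
    unfold adviceName
    split_ifs at h ⊢ <;> omega
  · rw [← initSeg, adviceTable_initSeg, adviceName, if_pos rfl]
    split_ifs <;> rfl

/-- Entry `n` depends only on the first `n` entries of `r`. This gives the openness of the
complement of the set of successful advice. -/
theorem continuous_adviceName (A : List ℕ → ℕ → Option ℕ) (p : Baire) :
    Continuous (adviceName A p) := by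
  refine continuous_pi fun n => IsLocallyConstant.continuous ?_
  refine (IsLocallyConstant.iff_eventually_eq _).2 fun r => ?_
  have hev : ∀ᶠ r' in nhds r, ∀ i ∈ Finset.range n, r' i = r i :=
    (Finset.eventually_all _).2 fun i _ =>
      (continuous_apply i).continuousAt.eventually_mem ((isOpen_discrete {r i}).mem_nhds rfl)
  filter_upwards [hev] with r' hr'
  have : initSeg (pairing p r') n = initSeg (pairing p r) n :=
    List.map_congr_left fun i hi => by
      have hi : i < n := List.mem_range.1 hi
      simp only [pairing, hr' (i / 2) (Finset.mem_range.2 (by omega))]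
  simp only [adviceName, this]

theorem exists_adviceName_eq_zero_iff {A : List ℕ → ℕ → Option ℕ} {Φ : Baire → ℕ →. ℕ}
    (hA : Approximates A Φ) {p r s : Baire} (hs : ∀ n, s n ∈ Φ (pairing p r) n) :
    (∃ n, adviceName A p r n = 0) ↔ ∃ n, s n = 0 := by
  constructor
  · rintro ⟨n, hn⟩
    have h : A (initSeg (pairing p r) n) n.unpair.1 = some 0 := by
      by_contra h
      simp [adviceName, h] at hn
    exact ⟨_, Part.mem_unique (hs _) (hA.sound h)⟩
  · rintro ⟨n, hn⟩
    obtain ⟨k, hk⟩ := Filter.eventually_atTop.1 (hA.complete (hn ▸ hs n))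
    -- This entry examines position `n` at stage `Nat.pair n k ≥ k`, which is late enough for the
    -- approximation to have found the zero.
    refine ⟨Nat.pair n k, ?_⟩
    simp [adviceName, hk _ (Nat.right_le_pair n k)]

theorem weihrauchReducible_of_nonDetComputable {X Y : Type*} {δX : Representation X}
    {δY : Representation Y} {A : Set Baire} {f : X → Set Y} (h : NonDetComputable δX δY A f) :
    WeihrauchReducible δX δY (negRep (subspaceRep A)) (subspaceRep A) f
      (closedChoice (subspaceRep A)) := by
  obtain ⟨F₁, F₂, hF₁, ⟨Φ, hΦ, hF₂⟩, hf⟩ := h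
  obtain ⟨T, hT⟩ := hΦ.exists_approximates
  let q : Baire → Baire := fun p c => adviceTable T (initSeg p c) c
  have hq : TotalRec q :=
    (totalRec_initSeg.pair TotalRec.id).map (primrec_adviceTable hT.primrec)
  refine ⟨F₁, fun p => Part.some (q p), hF₁, ⟨_, hq, fun p => ?_⟩, fun G hG p x hp hx => ?_⟩
  · exact (Part.eq_some_iff.2 (mem_sequenceOf.2 fun n => Part.mem_some _)).symm
  obtain ⟨hdom, ⟨r₀, hr₀, s₀, hs₀, hs₀F⟩, hsucc⟩ := hf p x hp hx
  have hΦs : ∀ {r s}, s ∈ F₂ (pairing p r) → ∀ n, s n ∈ Φ (pairing p r) n := fun h =>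
    mem_sequenceOf.1 (hF₂ _ ▸ h)
  -- Defined through the approximations, `B` has a name computable from `p`; since `F₂⟨p, r⟩` is
  -- defined for all `r ∈ A`, `hB` identifies `B` with the successful advice.
  let B : Set A := {r | ∀ n, adviceName T p r.1 n ≠ 0}
  have hchi : ∀ r : A, sierpinski.IsName (adviceName T p r.1) (chi Bᶜ r) := fun r => by
    simp [sierpinski, chi, B]
  have hBo : IsOpenSet (subspaceRep A) Bᶜ := by
    refine ⟨fun r => Part.some (adviceName T p r), ?_, ?_⟩
    · exact (continuous_adviceName T p).comp continuous_subtype_val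
    · rintro _ r rfl -
      exact ⟨_, Part.mem_some _, _, hchi r, rfl⟩
  have hname : (negRep (subspaceRep A)).IsName (q p) ⟨B, hBo⟩ := by
    rintro _ r rfl -
    exact ⟨_, adviceName_mem_eta T p r.1, _, hchi r, rfl⟩
  have hB : ∀ {r : A} {s}, s ∈ F₂ (pairing p r) → (r ∈ B ↔ sierpinski.IsName s False) := by
    intro r s hs
    have := exists_adviceName_eq_zero_iff hT (hΦs hs)
    simp only [B, sierpinski, Set.mem_ofPred_eq, false_iff, ← this, not_exists, ne_eq]
  obtain ⟨r, hr, a, rfl, ha⟩ := hG (q p) ⟨B, hBo⟩ hname ⟨⟨r₀, hr₀⟩, (hB hs₀).2 hs₀F⟩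
  obtain ⟨s, hs⟩ := Part.dom_iff_mem.1 (hdom a.1 a.2)
  obtain ⟨z, hz, hy⟩ := hsucc a.1 a.2 ⟨s, hs, (hB hs).1 ha⟩
  exact ⟨z, Part.mem_bind (Part.mem_some _) (Part.mem_bind hr hz), hy⟩

end TTE

theorem mainTheorem2 {X Y : Type*} (δX : TTE.Representation X) (δY : TTE.Representation Y)
    (A : Set TTE.Baire) (f : X → Set Y) :
    TTE.WeihrauchReducible δX δY (TTE.negRep (TTE.subspaceRep A)) (TTE.subspaceRep A)
      f (TTE.closedChoice (TTE.subspaceRep A)) ↔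
    TTE.NonDetComputable δX δY A f :=
  ⟨TTE.nonDetComputable_of_weihrauchReducible, TTE.weihrauchReducible_of_nonDetComputable⟩
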